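/- Let $r\ge 1$, $n=2r$. Define complex $2^r\times 2^r$ matrices $E_1,\dots,E_{2r+1}$ recursively: for $r=0$, $E_1=[-i]$; and if $E_1,\dots,E_{2r+1}$ are the matrices of size $2^r$, the matrices of size $2^{r+1}$ are $$\begin{bmatrix}0&E_j\\E_j&0\end{bmatrix}\ (1\le j\le 2r+1),\qquad \begin{bmatrix}0&-I\\I&0\end{bmatrix},\qquad \begin{bmatrix}-iI&0\\0&iI\end{bmatrix}.$$ Let $\Delta=\mathbb C^{2^r}$, and let $\Delta^{\pm}\subset\Delta$ be the $\pm1$ eigenspaces of the grading operator $i^rE_1E_2\cdots E_n=iE_{n+1}$. For $x\in\mathbb R^n$ let $\sigma(x)=\sum_{j=1}^n i x_jE_j$, which restricts to a linear map $\sigma(x):\Delta^+\to\Delta^-$ that is an isomorphism for $x\neq0$. Let $S^n\subset\mathbb R^{n+1}$ be the unit sphere with closed hemispheres $S^n_+=\{x_{n+1}\ge0\}$ and $S^n_-=\{x_{n+1}\le0\}$, each identified with the closed unit ball of $\mathbb R^n$ by $(x_1,\dots,x_{n+1})\mapsto(x_1,\dots,x_n)$. For complex vector bundles $E,F$ on $\mathbb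 R^n$ and a vector bundle map $\sigma:E\to F$ that is an isomorphism on the unit sphere and outside the unit ball, let $$c(E,F,\sigma)=E|_{S^n_+}\cup_\sigma F|_{S^n_-}$$ be the vector bundle on $S^n$ obtained from the disjoint union of $E$ over $S^n_+$ and $F$ over $S^n_-$ by identifying, over the equator, $e\in E_x$ with $\sigma(x)e\in F_x$. The positive spinor bundle $S^+$ of $S^n$ is the subbundle of $S^n\times\Delta$ whose fibre at $x\in S^n$ is the $+1$ eigenspace of $\sum_{j=1}^{n+1}i x_jE_j$, and the Bott generator vector bundle $\beta$ on $S^n$ is the dual bundle $(S^+)^*$. Then: 1. $c(\mathbb R^n\times\Delta^+,\ \mathbb R^n\times\Delta^-,\ \sigma)$ is isomorphic, as a complex vector bundle on $S^n$, to $S^+$. 2. For the conjugate triple, $c(\mathbb R^n\times\overline{\Delta^+},\ \mathbb R^n\times\overline{\Delta^-},\ \sigma)$ is isomorphic, as a complex vector bundle on $S^n$, to $\beta$. Here $\overline V$ is the complex conjugate of the vector space $V$, and $\sigma(x)$ is the same map as before, regarded as a linear map of the conjugate spaces. -/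

import Mathlib

open Bundle Topology

noncomputable section

/-! ### The Dirac matrices -/

/-- The `2 × 2` block matrix `[A, B; C, D]` with blocks of size `2 ^ r`, as a matrix of
size `2 ^ (r + 1)`. -/
def blockMatrix {r : ℕ} (A B C D : Matrix (Fin (2 ^ r)) (Fin (2 ^ r)) ℂ) :
    Matrix (Fin (2 ^ (r + 1))) (Fin (2 ^ (r + 1))) ℂ :=
  Matrix.reindex (finSumFinEquiv.trans (finCongr (by rw [pow_succ]; ring)))
    (finSumFinEquiv.trans (finCongr (by rw [pow_succ]; ring))) (Matrix.fromBlocks A B C D)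

/-- The matrices `E_1, …, E_{2r+1}` of size `2 ^ r` (numbered from `0`). The first `2r` of them are
the matrices belonging to the even dimension `2r`. One step of this recursion is the passage from
the odd dimension `2r+1` to `2r+2`, followed by the passage from `2r+2` to `2r+3`. -/
def diracE : (r : ℕ) → Fin (2 * r + 1) → Matrix (Fin (2 ^ r)) (Fin (2 ^ r)) ℂ
  | 0, _ => (-Complex.I) • 1
  | r + 1, j =>
    if h : (j : ℕ) < 2 * r + 1 then
      blockMatrix 0 (diracE r ⟨j, h⟩) (diracE r ⟨j, h⟩) 0
    else if (j : ℕ) = 2 * r + 1 then blockMatrix 0 (-1) 1 0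
    else blockMatrix ((-Complex.I) • 1) 0 0 (Complex.I • 1)

theorem blockMatrix_mul {r : ℕ} (A B C D A' B' C' D' : Matrix (Fin (2 ^ r)) (Fin (2 ^ r)) ℂ) :
    blockMatrix A B C D * blockMatrix A' B' C' D' =
      blockMatrix (A * A' + B * C') (A * B' + B * D') (C * A' + D * C') (C * B' + D * D') := by
  simp only [blockMatrix, Matrix.reindex_apply]
  rw [Matrix.submatrix_mul_equiv, Matrix.fromBlocks_multiply]

theorem blockMatrix_add {r : ℕ} (A B C D A' B' C' D' : Matrix (Fin (2 ^ r)) (Fin (2 ^ r)) ℂ) :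
    blockMatrix A B C D + blockMatrix A' B' C' D' =
      blockMatrix (A + A') (B + B') (C + C') (D + D') := by
  simp only [blockMatrix, Matrix.reindex_apply, ← Matrix.fromBlocks_add, Matrix.submatrix_add]
  rfl

theorem blockMatrix_smul {r : ℕ} (c : ℂ) (A B C D : Matrix (Fin (2 ^ r)) (Fin (2 ^ r)) ℂ) :
    c • blockMatrix A B C D = blockMatrix (c • A) (c • B) (c • C) (c • D) := by
  simp only [blockMatrix, Matrix.reindex_apply, ← Matrix.fromBlocks_smul, Matrix.submatrix_smul]
  rfl

theorem blockMatrix_one {r : ℕ} :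
    blockMatrix (1 : Matrix (Fin (2 ^ r)) (Fin (2 ^ r)) ℂ) 0 0 1 = 1 := by
  rw [blockMatrix, Matrix.fromBlocks_one, Matrix.reindex_apply, Matrix.submatrix_one_equiv]

theorem diracE_anticomm : ∀ (r : ℕ) (j k : Fin (2 * r + 1)),
    diracE r j * diracE r k + diracE r k * diracE r j =
      (if j = k then (-2 : ℂ) else 0) • (1 : Matrix (Fin (2 ^ r)) (Fin (2 ^ r)) ℂ)
  | 0, j, k => by
    have : j = k := Subsingleton.elim (α := Fin 1) j k
    subst this
    simp only [diracE, if_true, smul_mul_smul_comm, mul_one, ← add_smul]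
    congr 1
    linear_combination 2 * Complex.I_mul_I
  | r + 1, j, k => by
    have key : ∀ a b : ℂ, a • (1 : Matrix (Fin (2 ^ (r + 1))) (Fin (2 ^ (r + 1))) ℂ) =
        blockMatrix (a • 1) 0 0 (a • 1) := fun a _ => by
      rw [← blockMatrix_one, blockMatrix_smul]; simp
    rw [key _ 0]
    have hj := j.2
    have hk := k.2
    have ih := diracE_anticomm r
    have e2 : ∀ A : Matrix (Fin (2 ^ r)) (Fin (2 ^ r)) ℂ, A + A = (2 : ℂ) • A := fun A => by
      rw [two_smul]
    by_cases h1 : (j : ℕ) < 2 * r + 1 <;> by_cases h2 : (k : ℕ) < 2 * r + 1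
    · have := ih ⟨j, h1⟩ ⟨k, h2⟩
      simp only [Fin.mk.injEq] at this
      simp [diracE, h1, h2, blockMatrix_mul, blockMatrix_add, this, Fin.ext_iff]
    · have hne : j ≠ k := by rintro rfl; exact h2 h1
      by_cases h3 : (k : ℕ) = 2 * r + 1 <;>
        simp [diracE, h1, h2, h3, blockMatrix_mul, blockMatrix_add, hne]
    · have hne : j ≠ k := by rintro rfl; exact h1 h2
      by_cases h3 : (j : ℕ) = 2 * r + 1 <;>
        simp [diracE, h1, h2, h3, blockMatrix_mul, blockMatrix_add, hne]
    · by_cases h3 : (j : ℕ) = 2 * r + 1 <;> by_cases h4 : (k : ℕ) = 2 * r + 1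
      · have : j = k := Fin.ext (by omega)
        subst this
        simp [diracE, h3, blockMatrix_mul, blockMatrix_add, e2, -Matrix.neg_mul]
      · have hne : j ≠ k := by rintro rfl; exact h4 h3
        simp [diracE, h1, h2, h3, h4, blockMatrix_mul, blockMatrix_add, hne]
      · have hne : j ≠ k := by rintro rfl; exact h3 h4
        simp [diracE, h1, h2, h3, h4, blockMatrix_mul, blockMatrix_add, hne]
      · have : j = k := Fin.ext (by omega)
        subst this
        simp [diracE, h1, h3, blockMatrix_mul, blockMatrix_add, smul_smul, e2]

/-- Product of an odd number of block-antidiagonal matrices `[0, A; A, 0]`. -/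
theorem prod_blockMatrix_odd {r : ℕ} : ∀ (m : ℕ)
    (f : Fin (2 * m + 1) → Matrix (Fin (2 ^ r)) (Fin (2 ^ r)) ℂ),
    (List.ofFn fun j => blockMatrix 0 (f j) (f j) 0).prod =
      blockMatrix 0 (List.ofFn f).prod (List.ofFn f).prod 0
  | 0, f => by simp [List.ofFn_succ]
  | m + 1, f => by
    have ih := prod_blockMatrix_odd m (fun j => f j.succ.succ)
    rw [List.ofFn_succ, List.ofFn_succ (f := f), List.ofFn_succ, List.ofFn_succ (n := 2 * m + 1)]
    simp only [List.prod_cons]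
    erw [ih]
    simp [blockMatrix_mul]

theorem prod_diracE_odd : ∀ r : ℕ,
    Complex.I ^ (r + 1) • (List.ofFn (diracE r)).prod = 1
  | 0 => by
    simp [List.ofFn_succ, diracE, smul_smul]
  | r + 1 => by
    have ih := prod_diracE_odd r
    have h : List.ofFn (diracE (r + 1)) =
        (List.ofFn (fun j => blockMatrix 0 (diracE r j) (diracE r j) 0) ++
          [blockMatrix 0 (-1) 1 0]) ++ [blockMatrix ((-Complex.I) • 1) 0 0 (Complex.I • 1)] := by
      rw [List.ofFn_succ', List.concat_eq_append]
      congr 1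
      · change List.ofFn (n := (2 * r + 1) + 1) (fun j => diracE (r + 1) j.castSucc) = _
        rw [List.ofFn_succ', List.concat_eq_append]
        congr 1
        · congr 1
          funext j
          have := j.2
          simp [diracE]
          omega
        · simp [diracE]
      · simp [diracE]
        omega
    rw [h, List.prod_append, List.prod_append, prod_blockMatrix_odd]
    generalize (List.ofFn (diracE r)).prod = P at ih
    have hI : Complex.I ^ (r + 1 + 1) * -Complex.I = Complex.I ^ (r + 1) := by
      linear_combination (-Complex.I ^ (r + 1)) * Complex.I_mul_I
    have hI' : (Complex.I ^ (r + 1 + 1) * Complex.I) • (P * -1) = 1 := by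
      rw [mul_neg, mul_one, smul_neg, ← neg_smul, ← mul_neg, hI, ih]
    simp only [List.prod_cons, List.prod_nil, mul_one, blockMatrix_mul, mul_zero, zero_mul,
      add_zero, zero_add, smul_zero, blockMatrix_smul, Matrix.mul_smul, smul_smul, hI, hI',
      ih, blockMatrix_one]

/-! ### Spinors and Clifford multiplication -/

/-- The spinor space `Δ = ℂ^(2^r)`. -/
abbrev Spinor (r : ℕ) : Type := EuclideanSpace ℂ (Fin (2 ^ r))

/-- The unit sphere `S^n` in `ℝ^(n+1)`. -/
abbrev Sph (n : ℕ) : Type := Metric.sphere (0 : EuclideanSpace ℝ (Fin (n + 1))) 1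

/-- The operator `i c(x) = ∑ i x_j E_j` on `Δ`, for `x ∈ ℝ^(2r+1)`. -/
def cliffordI (r : ℕ) (x : EuclideanSpace ℝ (Fin (2 * r + 1))) : Spinor r →L[ℂ] Spinor r :=
  Matrix.toEuclideanCLM (𝕜 := ℂ) (∑ j, (Complex.I * (x j : ℂ)) • diracE r j)

/-- The operator `σ(x) = ∑ i x_j E_j` on `Δ`, for `x ∈ ℝ^(2r)`. -/
def diracSymbol (r : ℕ) (x : EuclideanSpace ℝ (Fin (2 * r))) : Spinor r →L[ℂ] Spinor r :=
  Matrix.toEuclideanCLM (𝕜 := ℂ) (∑ j : Fin (2 * r), (Complex.I * (x j : ℂ)) • diracE r j.castSucc)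

/-- The grading operator `i^r E_1 E_2 ⋯ E_{2r}` on `Δ`. -/
def grading (r : ℕ) : Spinor r →L[ℂ] Spinor r :=
  Matrix.toEuclideanCLM (𝕜 := ℂ)
    (Complex.I ^ r • (List.ofFn fun j : Fin (2 * r) => diracE r j.castSucc).prod)

/-- `Δ⁺`, the `+1` eigenspace of the grading operator. -/
def spinorPos (r : ℕ) : Submodule ℂ (Spinor r) :=
  Module.End.eigenspace (grading r : Spinor r →ₗ[ℂ] Spinor r) 1

/-- `Δ⁻`, the `-1` eigenspace of the grading operator. -/
def spinorNeg (r : ℕ) : Submodule ℂ (Spinor r) :=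
  Module.End.eigenspace (grading r : Spinor r →ₗ[ℂ] Spinor r) (-1)

theorem mem_spinorPos {r : ℕ} {v : Spinor r} : v ∈ spinorPos r ↔ grading r v = v := by
  simp [spinorPos]

theorem mem_spinorNeg {r : ℕ} {v : Spinor r} : v ∈ spinorNeg r ↔ grading r v = -v := by
  simp [spinorNeg]

theorem cliffordI_anticomm (r : ℕ) (x y : EuclideanSpace ℝ (Fin (2 * r + 1))) :
    cliffordI r x * cliffordI r y + cliffordI r y * cliffordI r x =
      (2 * ((inner ℝ x y : ℝ) : ℂ)) • (1 : Spinor r →L[ℂ] Spinor r) := by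
  have h : (∑ j, (Complex.I * (x j : ℂ)) • diracE r j) * (∑ j, (Complex.I * (y j : ℂ)) • diracE r j)
      + (∑ j, (Complex.I * (y j : ℂ)) • diracE r j) * (∑ j, (Complex.I * (x j : ℂ)) • diracE r j) =
      (2 * ((inner ℝ x y : ℝ) : ℂ)) • (1 : Matrix (Fin (2 ^ r)) (Fin (2 ^ r)) ℂ) := by
    rw [Finset.sum_mul_sum, Finset.sum_mul_sum, Finset.sum_comm (γ := Fin (2 * r + 1)),
      ← Finset.sum_add_distrib]
    have : ∀ k j : Fin (2 * r + 1), ((Complex.I * (x j : ℂ)) • diracE r j) *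
        ((Complex.I * (y k : ℂ)) • diracE r k) + ((Complex.I * (y k : ℂ)) • diracE r k) *
        ((Complex.I * (x j : ℂ)) • diracE r j) =
        (if j = k then 2 * ((x j : ℂ) * (y k : ℂ)) else 0) •
          (1 : Matrix (Fin (2 ^ r)) (Fin (2 ^ r)) ℂ) := by
      intro k j
      rw [smul_mul_smul_comm, smul_mul_smul_comm,
        mul_comm (Complex.I * (y k : ℂ)), ← smul_add, diracE_anticomm, smul_smul]
      congr 1
      split_ifs
      · linear_combination (-2 * (x j : ℂ) * y k) * Complex.I_mul_I
      · simp
    simp_rw [← Finset.sum_add_distrib, this, ← Finset.sum_smul]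
    congr 1
    simp [PiLp.inner_apply, Finset.mul_sum, mul_comm]
  have := congrArg (Matrix.toEuclideanCLM (𝕜 := ℂ) (n := Fin (2 ^ r))) h
  simp only [map_add, map_mul, map_smul, map_one] at this
  exact this

/-- The point `(x, 0)` of `ℝ^(n+1)` over `x ∈ ℝ^n`. -/
def equator {n : ℕ} (x : EuclideanSpace ℝ (Fin n)) : EuclideanSpace ℝ (Fin (n + 1)) :=
  WithLp.toLp 2 (Fin.snoc (α := fun _ => ℝ) x.ofLp 0)

/-- The north pole `(0, …, 0, 1)` of `S^n`. -/
def northPole (n : ℕ) : Sph n :=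
  ⟨EuclideanSpace.single (Fin.last n) 1, by simp⟩

theorem inner_equator_northPole {n : ℕ} (x : EuclideanSpace ℝ (Fin n)) :
    inner ℝ (equator x) (northPole n).1 = 0 := by
  simp [northPole, equator, EuclideanSpace.inner_single_right]

theorem inner_equator_self {n : ℕ} (x : EuclideanSpace ℝ (Fin n)) :
    inner ℝ (equator x) (equator x) = ‖x‖ ^ 2 := by
  rw [real_inner_self_eq_norm_sq, EuclideanSpace.norm_sq_eq, EuclideanSpace.norm_sq_eq,
    Fin.sum_univ_castSucc]
  simp [equator]

theorem cliffordI_equator (r : ℕ) (x : EuclideanSpace ℝ (Fin (2 * r))) :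
    cliffordI r (equator x) = diracSymbol r x := by
  simp [cliffordI, diracSymbol, equator, Fin.sum_univ_castSucc]

/-- The grading operator `i^r E_1 ⋯ E_n` is `i E_{n+1}`. -/
theorem grading_eq (r : ℕ) : grading r = cliffordI r (northPole (2 * r)).1 := by
  have h1 := prod_diracE_odd r
  rw [List.ofFn_succ', List.concat_eq_append, List.prod_append, List.prod_singleton] at h1
  have h2 := diracE_anticomm r (Fin.last _) (Fin.last _)
  have h3 : diracE r (Fin.last _) * diracE r (Fin.last _) = -1 := by
    have h : (2 : ℂ) • (diracE r (Fin.last _) * diracE r (Fin.last _)) = (2 : ℂ) • (-1) := by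
      rw [two_smul, h2]; simp
    exact (smul_right_injective _ (two_ne_zero (α := ℂ))) h
  have h4 := congrArg (fun M => (-Complex.I) • (M * diracE r (Fin.last _))) h1
  simp only [smul_mul_assoc, mul_assoc, h3, one_mul, smul_smul, mul_neg, mul_one] at h4
  have h5 : -(Complex.I * Complex.I ^ (r + 1)) = Complex.I ^ r := by
    linear_combination (-Complex.I ^ r) * Complex.I_mul_I
  rw [grading, cliffordI]
  congr 1
  have h6 : ∑ j, (Complex.I * (((northPole (2 * r)).1 j : ℝ) : ℂ)) • diracE r j =
      Complex.I • diracE r (Fin.last _) := by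
    rw [Finset.sum_eq_single (Fin.last (2 * r))]
    · simp [northPole]
    · intro j _ hj
      simp [northPole, hj]
    · simp
  rw [h6]
  simpa [h5] using h4

theorem diracSymbol_grading (r : ℕ) (x : EuclideanSpace ℝ (Fin (2 * r))) (v : Spinor r) :
    grading r (diracSymbol r x v) = -diracSymbol r x (grading r v) := by
  have h := cliffordI_anticomm r (equator x) (northPole (2 * r)).1
  rw [inner_equator_northPole, cliffordI_equator, ← grading_eq] at h
  have h' := congrArg (fun T => T v) h
  simp only [add_apply, mul_apply_eq_comp] at h'
  rw [eq_neg_iff_add_eq_zero, add_comm, h']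
  simp

theorem diracSymbol_sq (r : ℕ) (x : EuclideanSpace ℝ (Fin (2 * r))) (v : Spinor r) :
    diracSymbol r x (diracSymbol r x v) = ((‖x‖ ^ 2 : ℝ) : ℂ) • v := by
  have h := cliffordI_anticomm r (equator x) (equator x)
  rw [inner_equator_self, cliffordI_equator, ← two_smul ℂ, mul_smul] at h
  have h' := smul_right_injective _ (two_ne_zero (α := ℂ)) h
  exact congrArg (fun T => T v) h'

/-- `σ(x)` as a linear map `Δ⁺ → Δ⁻`. -/
def diracSymbolPos (r : ℕ) (x : EuclideanSpace ℝ (Fin (2 * r))) : spinorPos r →ₗ[ℂ] spinorNeg r :=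
  (diracSymbol r x : Spinor r →ₗ[ℂ] Spinor r).restrict fun v hv => by
    have hv' := mem_spinorPos.1 hv
    exact mem_spinorNeg.2 (by
      rw [ContinuousLinearMap.coe_coe, diracSymbol_grading, hv'])

theorem coe_diracSymbolPos (r : ℕ) (x : EuclideanSpace ℝ (Fin (2 * r))) (v : spinorPos r) :
    (diracSymbolPos r x v : Spinor r) = diracSymbol r x v := rfl

theorem diracSymbolPos_bijective (r : ℕ) {x : EuclideanSpace ℝ (Fin (2 * r))} (hx : x ≠ 0) :
    Function.Bijective (diracSymbolPos r x) := by
  have hc : ((‖x‖ ^ 2 : ℝ) : ℂ) ≠ 0 := by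
    exact_mod_cast pow_ne_zero 2 (norm_ne_zero_iff.2 hx)
  constructor
  · intro v w h
    have h1 : diracSymbol r x v = diracSymbol r x w := congrArg Subtype.val h
    have h2 := congrArg (diracSymbol r x) h1
    rw [diracSymbol_sq, diracSymbol_sq] at h2
    exact Subtype.ext (smul_right_injective _ hc h2)
  · intro w
    have hw := mem_spinorNeg.1 w.2
    refine ⟨⟨(((‖x‖ ^ 2 : ℝ) : ℂ))⁻¹ • diracSymbol r x w, mem_spinorPos.2 ?_⟩, Subtype.ext ?_⟩
    · rw [map_smul, diracSymbol_grading, hw, map_neg, neg_neg]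
    · rw [coe_diracSymbolPos, map_smul, diracSymbol_sq, smul_smul, inv_mul_cancel₀ hc, one_smul]

/-! ### The positive spinor bundle of the sphere -/

/-- The fibre at `x ∈ S^(2r)` of the positive spinor bundle, as a subspace of `Δ`: the `+1`
eigenspace of `i c(x)`. -/
def posSpinorSubspace (r : ℕ) (x : Sph (2 * r)) : Submodule ℂ (Spinor r) :=
  Module.End.eigenspace (cliffordI r x.1 : Spinor r →ₗ[ℂ] Spinor r) 1

/-- The fibres of the positive spinor bundle `S⁺` of `S^(2r)`. -/
def PosSpinorBundle (r : ℕ) (x : Sph (2 * r)) : Type := posSpinorSubspace r x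

namespace PosSpinorBundle

variable {r : ℕ}

instance (x : Sph (2 * r)) : NormedAddCommGroup (PosSpinorBundle r x) :=
  inferInstanceAs (NormedAddCommGroup (posSpinorSubspace r x))

instance (x : Sph (2 * r)) : NormedSpace ℂ (PosSpinorBundle r x) :=
  inferInstanceAs (NormedSpace ℂ (posSpinorSubspace r x))

instance (x : Sph (2 * r)) : FiniteDimensional ℂ (PosSpinorBundle r x) :=
  inferInstanceAs (FiniteDimensional ℂ (posSpinorSubspace r x))

/-- The inclusion of a fibre of the positive spinor bundle in `Δ`. -/
def incl (x : Sph (2 * r)) : PosSpinorBundle r x →L[ℂ] Spinor r :=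
  (posSpinorSubspace r x).subtypeL

theorem incl_injective (x : Sph (2 * r)) : Function.Injective (incl x) :=
  Subtype.val_injective

theorem mem_posSpinorSubspace {x : Sph (2 * r)} {v : Spinor r} :
    v ∈ posSpinorSubspace r x ↔ cliffordI r x.1 v = v := by
  simp [posSpinorSubspace]

theorem cliffordI_incl (x : Sph (2 * r)) (v : PosSpinorBundle r x) :
    cliffordI r x.1 (incl x v) = incl x v := by
  exact mem_posSpinorSubspace.1 v.2

/-- The total space of `S⁺` is topologized as a subspace of `S^(2r) × Δ`. -/
instance : TopologicalSpace (TotalSpace (spinorPos r) (PosSpinorBundle r)) :=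
  TopologicalSpace.induced (fun p => (p.1, incl p.1 p.2)) inferInstance

theorem isInducing_total : IsInducing (fun p : TotalSpace (spinorPos r) (PosSpinorBundle r) =>
    ((p.1, incl p.1 p.2) : Sph (2 * r) × Spinor r)) := ⟨rfl⟩

/-- The projection `(1 + i c(x)) / 2` of `Δ` onto the fibre of `S⁺` at `x`. -/
def proj (x : Sph (2 * r)) : Spinor r →L[ℂ] PosSpinorBundle r x :=
  ((1 / 2 : ℂ) • (1 + cliffordI r x.1)).codRestrict (posSpinorSubspace r x) fun v => by
    have h := cliffordI_anticomm r x.1 x.1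
    rw [real_inner_self_eq_norm_sq, norm_eq_of_mem_sphere, ← two_smul ℂ, mul_smul] at h
    have h' := congrArg (fun T => T v) (smul_right_injective _ (two_ne_zero (α := ℂ)) h)
    simp only [mul_apply_eq_comp] at h'
    rw [mem_posSpinorSubspace]
    simp [h', add_comm]

theorem incl_proj (x : Sph (2 * r)) (v : Spinor r) :
    incl x (proj x v) = (1 / 2 : ℂ) • (v + cliffordI r x.1 v) := rfl

/-- Compressing the projection at `u` to the fibre at `x` gives a scalar. -/
theorem proj_incl_proj (x u : Sph (2 * r)) (v : PosSpinorBundle r x) :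
    proj x (incl u (proj u (incl x v))) = (((1 + inner ℝ x.1 u.1) / 2 : ℝ) : ℂ) • v := by
  apply incl_injective
  have h := congrArg (fun T => T (incl x v)) (cliffordI_anticomm r x.1 u.1)
  simp only [add_apply, mul_apply_eq_comp, cliffordI_incl,
    smul_apply, one_apply_eq_self] at h
  rw [incl_proj, incl_proj, map_smul, map_smul, map_add, cliffordI_incl, eq_sub_of_add_eq h]
  push_cast
  module

theorem continuous_cliffordI : Continuous (fun x : Sph (2 * r) => cliffordI r x.1) := by
  unfold cliffordI
  have h : Continuous (Matrix.toEuclideanCLM (𝕜 := ℂ) (n := Fin (2 ^ r))) :=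
    LinearMap.continuous_of_finiteDimensional
      (Matrix.toEuclideanCLM (𝕜 := ℂ) (n := Fin (2 ^ r))).toAlgEquiv.toLinearMap
  refine h.comp (continuous_finsetSum _ fun j _ => ?_)
  fun_prop

theorem continuous_incl_proj :
    Continuous (fun x : Sph (2 * r) => (incl x).comp (proj x)) := by
  have : (fun x : Sph (2 * r) => (incl x).comp (proj x)) =
      fun x : Sph (2 * r) => (1 / 2 : ℂ) • (1 + cliffordI r x.1) := rfl
  rw [this]
  have := continuous_cliffordI (r := r)
  fun_prop

/-- The fibres over two points that are not antipodal are isomorphic. -/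
def equivOfNotAntipodal (x u : Sph (2 * r)) (h : 1 + inner ℝ x.1 u.1 ≠ 0) :
    PosSpinorBundle r x ≃ₗ[ℂ] PosSpinorBundle r u :=
  have hc : (((1 + inner ℝ x.1 u.1) / 2 : ℝ) : ℂ) ≠ 0 := by
    exact_mod_cast div_ne_zero h two_ne_zero
  LinearEquiv.ofLinearMap ((proj u).comp (incl x)).toLinearMap
    ((((1 + inner ℝ x.1 u.1) / 2 : ℝ) : ℂ)⁻¹ • ((proj x).comp (incl u)).toLinearMap)
    (by
      ext v : 1
      simp only [LinearMap.comp_apply, LinearMap.smul_apply, ContinuousLinearMap.coe_coe, map_smul,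
        ContinuousLinearMap.comp_apply, LinearMap.id_apply]
      rw [proj_incl_proj, real_inner_comm x.1 u.1, inv_smul_smul₀ hc])
    (by
      ext v : 1
      simp only [LinearMap.comp_apply, LinearMap.smul_apply, ContinuousLinearMap.coe_coe,
        ContinuousLinearMap.comp_apply, LinearMap.id_apply]
      rw [proj_incl_proj, inv_smul_smul₀ hc])

theorem nonempty_equiv [NeZero r] (x : Sph (2 * r)) :
    Nonempty (PosSpinorBundle r x ≃L[ℂ] spinorPos r) := by
  have hN : posSpinorSubspace r (northPole (2 * r)) = spinorPos r := by
    rw [posSpinorSubspace, spinorPos, grading_eq]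
  have hr : 0 < 2 * r := by have := NeZero.pos r; omega
  let N := northPole (2 * r)
  suffices h : Nonempty (PosSpinorBundle r x ≃ₗ[ℂ] PosSpinorBundle r N) by
    obtain ⟨e⟩ := h
    exact ⟨(e.trans (LinearEquiv.ofEq _ _ hN)).toContinuousLinearEquiv⟩
  by_cases h : 1 + inner ℝ x.1 N.1 = 0
  · let j : Fin (2 * r + 1) := ⟨0, by omega⟩
    let y : Sph (2 * r) := ⟨EuclideanSpace.single j 1, by simp⟩
    have hj : j ≠ Fin.last (2 * r) := by
      intro h'
      have := congrArg Fin.val h'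
      simp [j] at this
      omega
    have hx : x.1 = -N.1 := by
      have h1 : inner ℝ x.1 (-N.1) = 1 := by rw [inner_neg_right]; linarith
      exact (inner_eq_one_iff_of_norm_eq_one (𝕜 := ℝ) (norm_eq_of_mem_sphere x)
        (by rw [norm_neg, norm_eq_of_mem_sphere])).1 h1
    have h1 : inner ℝ N.1 y.1 = 0 := by
      simp [N, y, northPole, EuclideanSpace.inner_single_right, hj]
    exact ⟨(equivOfNotAntipodal x y (by rw [hx, inner_neg_left, h1]; simp)).trans
      (equivOfNotAntipodal y N (by rw [real_inner_comm, h1]; simp))⟩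
  · exact ⟨equivOfNotAntipodal x N h⟩

/-- The trivialization of `S⁺` over the complement of the antipode of `u` that is given by the
projection to the fibre at `u`, followed by an identification of that fibre with `Δ⁺`. -/
def triv (u : Sph (2 * r)) (τ : PosSpinorBundle r u ≃L[ℂ] spinorPos r) :
    Trivialization (spinorPos r) (π (spinorPos r) (PosSpinorBundle r)) where
  toFun p := (p.1, τ (proj u (incl p.1 p.2)))
  invFun q := ⟨q.1, (((1 + inner ℝ q.1.1 u.1) / 2 : ℝ) : ℂ)⁻¹ •
    proj q.1 (incl u (τ.symm q.2))⟩
  source := (π (spinorPos r) (PosSpinorBundle r)) ⁻¹' {x : Sph (2 * r) | 1 + inner ℝ x.1 u.1 ≠ 0}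
  target := {x : Sph (2 * r) | 1 + inner ℝ x.1 u.1 ≠ 0} ×ˢ Set.univ
  baseSet := {x : Sph (2 * r) | 1 + inner ℝ x.1 u.1 ≠ 0}
  map_source' p hp := ⟨hp, trivial⟩
  map_target' q hq := hq.1
  left_inv' p hp := by
    have hc : (((1 + inner ℝ p.1.1 u.1) / 2 : ℝ) : ℂ) ≠ 0 := by
      exact_mod_cast div_ne_zero hp two_ne_zero
    obtain ⟨x, v⟩ := p
    simp only [ContinuousLinearEquiv.symm_apply_apply, proj_incl_proj]
    rw [inv_smul_smul₀ hc]
  right_inv' q hq := by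
    have hc : (((1 + inner ℝ q.1.1 u.1) / 2 : ℝ) : ℂ) ≠ 0 := by
      exact_mod_cast div_ne_zero hq.1 two_ne_zero
    obtain ⟨x, w⟩ := q
    simp only [map_smul, proj_incl_proj, real_inner_comm]
    rw [real_inner_comm] at hc
    rw [inv_smul_smul₀ hc, ContinuousLinearEquiv.apply_symm_apply]
  open_source := by
    have h : Continuous (π (spinorPos r) (PosSpinorBundle r)) :=
      continuous_fst.comp isInducing_total.continuous
    refine IsOpen.preimage h (isOpen_ne_fun ?_ continuous_const)
    fun_prop
  open_target := by
    refine IsOpen.prod (isOpen_ne_fun ?_ continuous_const) isOpen_univ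
    fun_prop
  open_baseSet := by
    refine isOpen_ne_fun ?_ continuous_const
    fun_prop
  continuousOn_toFun := by
    refine Continuous.continuousOn (Continuous.prodMk ?_ ?_)
    · exact continuous_fst.comp isInducing_total.continuous
    · exact (τ.continuous.comp (proj u).continuous).comp
        (continuous_snd.comp isInducing_total.continuous)
  continuousOn_invFun := by
    rw [isInducing_total.continuousOn_iff]
    refine continuousOn_fst.prodMk ?_
    have h1 : ContinuousOn (fun q : Sph (2 * r) × spinorPos r =>
        (((1 + inner ℝ q.1.1 u.1) / 2 : ℝ) : ℂ)⁻¹)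
        ({x : Sph (2 * r) | 1 + inner ℝ x.1 u.1 ≠ 0} ×ˢ Set.univ) := by
      refine ContinuousOn.inv₀ (Continuous.continuousOn (by fun_prop)) fun q hq => ?_
      exact_mod_cast div_ne_zero hq.1 two_ne_zero
    have h2 : Continuous (fun q : Sph (2 * r) × spinorPos r =>
        ((incl q.1).comp (proj q.1)) (incl u (τ.symm q.2))) :=
      (continuous_incl_proj.comp continuous_fst).clm_apply
        (((incl u).continuous.comp τ.symm.continuous).comp continuous_snd)
    refine (h1.smul h2.continuousOn).congr fun q _ => ?_
    simp
  source_eq := rfl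
  target_eq := rfl
  proj_toFun p _ := rfl

instance fiberBundle [NeZero r] : FiberBundle (spinorPos r) (PosSpinorBundle r) where
  totalSpaceMk_isInducing' x := by
    rw [← IsInducing.of_comp_iff isInducing_total]
    exact isInducing_const_prod.2 IsInducing.subtypeVal
  trivializationAtlas' := {e | ∃ u τ, e = triv u τ}
  trivializationAt' x := triv x (nonempty_equiv x).some
  mem_baseSet_trivializationAt' x := by
    change 1 + inner ℝ x.1 x.1 ≠ 0
    rw [real_inner_self_eq_norm_sq, norm_eq_of_mem_sphere]
    norm_num
  trivialization_mem_atlas' x := ⟨x, _, rfl⟩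

instance triv_isLinear (u : Sph (2 * r)) (τ : PosSpinorBundle r u ≃L[ℂ] spinorPos r) :
    (triv u τ).IsLinear ℂ where
  linear x _ := by
    constructor
    · intro v w
      change τ (proj u (incl x (v + w))) = τ (proj u (incl x v)) + τ (proj u (incl x w))
      simp only [map_add]
    · intro c v
      change τ (proj u (incl x (c • v))) = c • τ (proj u (incl x v))
      simp only [map_smul]

instance vectorBundle [NeZero r] : VectorBundle ℂ (spinorPos r) (PosSpinorBundle r) where
  trivialization_linear' := by
    rintro _ ⟨u, τ, rfl⟩
    infer_instance
  continuousOn_coordChange' := by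
    rintro _ _ ⟨u, τ, rfl⟩ ⟨u', τ', rfl⟩
    have h1 : ContinuousOn (fun x : Sph (2 * r) => (((1 + inner ℝ x.1 u.1) / 2 : ℝ) : ℂ)⁻¹)
        {x : Sph (2 * r) | 1 + inner ℝ x.1 u.1 ≠ 0} := by
      refine ContinuousOn.inv₀ (Continuous.continuousOn (by fun_prop)) fun q hq => ?_
      exact_mod_cast div_ne_zero hq two_ne_zero
    have h2 : Continuous (fun x : Sph (2 * r) =>
        ((τ' : PosSpinorBundle r u' →L[ℂ] spinorPos r).comp (proj u')).comp
          (((incl x).comp (proj x)).comp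
            ((incl u).comp (τ.symm : spinorPos r →L[ℂ] PosSpinorBundle r u)))) :=
      continuous_const.clm_comp (continuous_incl_proj.clm_comp continuous_const)
    refine ((h1.mono Set.inter_subset_left).smul h2.continuousOn).congr fun x hx => ?_
    ext w : 1
    rw [ContinuousLinearEquiv.coe_coe, Trivialization.coordChangeL_apply' _ _ hx]
    change τ' (proj u' (incl x ((((1 + inner ℝ x.1 u.1) / 2 : ℝ) : ℂ)⁻¹ •
      proj x (incl u (τ.symm w))))) = _
    simp only [map_smul]
    rfl

end PosSpinorBundle

/-! ### Clutching -/

/-- Two families of complex vector spaces over `B`, with topologized total spaces, are isomorphic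
if there is a homeomorphism of their total spaces over `B` that is `ℂ`-linear in each fibre. -/
def BundleIsomorphic {B : Type*} (F₁ : Type*) (E₁ : B → Type*) (F₂ : Type*) (E₂ : B → Type*)
    [∀ x, AddCommGroup (E₁ x)] [∀ x, Module ℂ (E₁ x)] [TopologicalSpace (TotalSpace F₁ E₁)]
    [∀ x, AddCommGroup (E₂ x)] [∀ x, Module ℂ (E₂ x)] [TopologicalSpace (TotalSpace F₂ E₂)] :
    Prop :=
  ∃ φ : ∀ x, E₁ x ≃ₗ[ℂ] E₂ x,
    Continuous (fun p : TotalSpace F₁ E₁ => (⟨p.1, φ p.1 p.2⟩ : TotalSpace F₂ E₂)) ∧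
    Continuous (fun p : TotalSpace F₂ E₂ => (⟨p.1, (φ p.1).symm p.2⟩ : TotalSpace F₁ E₁))

/-- The last coordinate of a point of `S^n`. -/
def lastCoord {n : ℕ} (y : Sph n) : ℝ := y.1 (Fin.last n)

/-- The upper hemisphere `S^n_+`. -/
def UpperHemisphere (n : ℕ) : Type := {y : Sph n // 0 ≤ lastCoord y}

/-- The lower hemisphere `S^n_-`. -/
def LowerHemisphere (n : ℕ) : Type := {y : Sph n // lastCoord y ≤ 0}

instance (n : ℕ) : TopologicalSpace (UpperHemisphere n) :=
  inferInstanceAs (TopologicalSpace {y : Sph n // 0 ≤ lastCoord y})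

instance (n : ℕ) : TopologicalSpace (LowerHemisphere n) :=
  inferInstanceAs (TopologicalSpace {y : Sph n // lastCoord y ≤ 0})

/-- The projection `(x_1, …, x_{n+1}) ↦ (x_1, …, x_n)`. It identifies each closed hemisphere with
the unit ball of `ℝ^n`, and the equator with the unit sphere of `ℝ^n`. -/
def flatten {n : ℕ} (y : Sph n) : EuclideanSpace ℝ (Fin n) :=
  WithLp.toLp 2 fun j => y.1 j.castSucc

section Clutch

variable {n : ℕ} {E F : EuclideanSpace ℝ (Fin n) → Type*}
  [∀ x, AddCommGroup (E x)] [∀ x, Module ℂ (E x)]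
  [∀ x, AddCommGroup (F x)] [∀ x, Module ℂ (F x)]

/-- The relations that define the fibre at `y` of the clutched bundle as a quotient of
`E ⊕ F` (at the point of the unit ball below `y`): `F` is discarded in the open upper hemisphere,
`E` is discarded in the open lower hemisphere, and on the equator `e ∈ E` is identified with
`σ e ∈ F`. -/
def clutchRel (σ : ∀ x, E x →ₗ[ℂ] F x) (y : Sph n) :
    Submodule ℂ (E (flatten y) × F (flatten y)) where
  carrier := {p | (0 < lastCoord y → p.1 = 0) ∧ (lastCoord y < 0 → p.2 = 0) ∧
    (lastCoord y = 0 → p.2 = -σ (flatten y) p.1)}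
  add_mem' := by
    rintro p q ⟨h1, h2, h3⟩ ⟨h1', h2', h3'⟩
    refine ⟨fun h => ?_, fun h => ?_, fun h => ?_⟩
    · simp [h1 h, h1' h]
    · simp [h2 h, h2' h]
    · simp [h3 h, h3' h, add_comm]
  zero_mem' := by simp
  smul_mem' := by
    rintro c p ⟨h1, h2, h3⟩
    refine ⟨fun h => ?_, fun h => ?_, fun h => ?_⟩
    · simp [h1 h]
    · simp [h2 h]
    · simp [h3 h]

/-- The fibres of the bundle on `S^n` obtained by clutching `E` on the upper hemisphere to `F` on
the lower hemisphere via `σ : E → F` on the equator. -/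
def Clutch (σ : ∀ x, E x →ₗ[ℂ] F x) (y : Sph n) : Type _ :=
  (E (flatten y) × F (flatten y)) ⧸ clutchRel σ y

namespace Clutch

variable (σ : ∀ x, E x →ₗ[ℂ] F x)

instance (y : Sph n) : AddCommGroup (Clutch σ y) :=
  inferInstanceAs (AddCommGroup ((E (flatten y) × F (flatten y)) ⧸ clutchRel σ y))

instance (y : Sph n) : Module ℂ (Clutch σ y) :=
  inferInstanceAs (Module ℂ ((E (flatten y) × F (flatten y)) ⧸ clutchRel σ y))

/-- The inclusion of `E` over the upper hemisphere in the clutched bundle. -/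
def upper (M N : Type*)
    (p : TotalSpace M ((fun y : UpperHemisphere n => flatten y.1) *ᵖ E)) :
    TotalSpace (M × N) (Clutch σ) :=
  ⟨p.1.1, (clutchRel σ p.1.1).mkQ (p.2, 0)⟩

/-- The inclusion of `F` over the lower hemisphere in the clutched bundle. -/
def lower (M N : Type*)
    (p : TotalSpace N ((fun y : LowerHemisphere n => flatten y.1) *ᵖ F)) :
    TotalSpace (M × N) (Clutch σ) :=
  ⟨p.1.1, (clutchRel σ p.1.1).mkQ (0, p.2)⟩

/-- The total space of the clutched bundle carries the quotient topology from the disjoint union of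
`E` over the upper hemisphere and `F` over the lower hemisphere. The model fibres `M`, `N` of `E`,
`F` enter only as labels of the total spaces. -/
instance (M N : Type*) [TopologicalSpace (TotalSpace M E)] [TopologicalSpace (TotalSpace N F)] :
    TopologicalSpace (TotalSpace (M × N) (Clutch σ)) :=
  TopologicalSpace.coinduced (Sum.elim (upper σ M N) (lower σ M N)) inferInstance

end Clutch

end Clutch

/-! ### Conjugation and duality -/

/-- The conjugate of a complex vector space: the same additive group, on which `c` acts as its
complex conjugate did. -/
def ConjSpace (V : Type*) : Type _ := V

namespace ConjSpace

variable {V W : Type*} [AddCommGroup V] [Module ℂ V] [AddCommGroup W] [Module ℂ W]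

instance : AddCommGroup (ConjSpace V) := inferInstanceAs (AddCommGroup V)

instance : Module ℂ (ConjSpace V) := Module.compHom V (starRingEnd ℂ)

/-- A linear map is also a linear map of the conjugate spaces. -/
def map (f : V →ₗ[ℂ] W) : ConjSpace V →ₗ[ℂ] ConjSpace W where
  toFun := f
  map_add' := f.map_add
  map_smul' c v := f.map_smul (starRingEnd ℂ c) v

/-- The conjugate of a family of vector spaces has the same total space. -/
instance {B : Type*} (M : Type*) (E : B → Type*) [TopologicalSpace (TotalSpace M E)] :
    TopologicalSpace (TotalSpace (ConjSpace M) (fun x => ConjSpace (E x))) :=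
  TopologicalSpace.induced (fun p => (⟨p.1, p.2⟩ : TotalSpace M E)) inferInstance

end ConjSpace

/-- The Bott generator bundle `β` on `S^(2r)`: the dual of the positive spinor bundle. -/
abbrev BottBundle (r : ℕ) (x : Sph (2 * r)) : Type :=
  PosSpinorBundle r x →L[ℂ] Trivial (Sph (2 * r)) ℂ x

end

/-! The fibre of `S⁺` at `y` is the image of the projection `P_y = (1 + i c(y)) / 2`. At the north
pole this is `Δ⁺`, since `i c` there is the grading operator, and at the south pole it is `Δ⁻`. The
Clifford relations give `P_x P_u P_x = (1 + ⟨x, u⟩) / 2 · P_x` (`proj_incl_proj`), so `P_y` maps the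
fibre at `u` isomorphically onto the fibre at `y` unless `y = -u`. Hence `P_y` trivializes `S⁺` by
`Δ⁺` over the closed upper hemisphere and by `Δ⁻` over the closed lower one.

The two trivializations differ on the equator exactly by `σ`: for `y = (x, 0)` the operator `i c(y)`
is `σ(x)`, an involution, so `P_y (σ(x) e) = (σ(x) e + e) / 2 = P_y e` (`fromFibre_diracSymbolPos`).
No homotopy of clutching maps is needed. `Clutch.bundleIsomorphic` turns such data into a bundle
isomorphism.

For the conjugate triple, the matrices `E_j` are skew-Hermitian, so `P_y` is an orthogonal
projection and the Hermitian metric of `Δ` gives a conjugate-linear isomorphism `v ↦ ⟨v, ·⟩` from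
`S⁺` to its dual (`toBott`, with inverse `ofBott`). Composed with the trivializations above it
becomes complex linear on the conjugates of `Δ⁺` and `Δ⁻`, and the equatorial identity is inherited.
-/

noncomputable section

/-! ### A criterion for clutched bundles -/

namespace Clutch

section Criterion

variable {n : ℕ} {E F : EuclideanSpace ℝ (Fin n) → Type*}
  [∀ x, AddCommGroup (E x)] [∀ x, Module ℂ (E x)]
  [∀ x, AddCommGroup (F x)] [∀ x, Module ℂ (F x)]
  {E' : Sph n → Type*} [∀ y, AddCommGroup (E' y)] [∀ y, Module ℂ (E' y)]

/-- Linear maps from `E` and `F` to `E'` combine to a linear map from `E ⊕ F` that only uses the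
summands present over `y`. -/
def joint (a : ∀ y, E (flatten y) →ₗ[ℂ] E' y) (b : ∀ y, F (flatten y) →ₗ[ℂ] E' y) (y : Sph n) :
    E (flatten y) × F (flatten y) →ₗ[ℂ] E' y :=
  LinearMap.coprod (if 0 ≤ lastCoord y then a y else 0) (if lastCoord y ≤ 0 then b y else 0)

theorem continuous_lastCoord : Continuous (lastCoord : Sph n → ℝ) := by
  unfold lastCoord
  fun_prop

/-- A clutched bundle is isomorphic to `E'` as soon as both pieces are identified with the
restrictions of `E'` to the hemispheres, compatibly with the clutching map on the equator. -/
theorem bundleIsomorphic (σ : ∀ x, E x →ₗ[ℂ] F x) (M N F' : Type*)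
    [TopologicalSpace (TotalSpace M E)] [TopologicalSpace (TotalSpace N F)]
    [TopologicalSpace (TotalSpace F' E')]
    (hπ : Continuous (π F' E'))
    (a : ∀ y, E (flatten y) →ₗ[ℂ] E' y) (b : ∀ y, F (flatten y) →ₗ[ℂ] E' y)
    (a' : ∀ y, E' y → E (flatten y)) (b' : ∀ y, E' y → F (flatten y))
    (a'_a : ∀ y, 0 ≤ lastCoord y → ∀ e, a' y (a y e) = e)
    (a_a' : ∀ y, 0 ≤ lastCoord y → ∀ v, a y (a' y v) = v)
    (b'_b : ∀ y, lastCoord y ≤ 0 → ∀ f, b' y (b y f) = f)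
    (b_b' : ∀ y, lastCoord y ≤ 0 → ∀ v, b y (b' y v) = v)
    (hab : ∀ y, lastCoord y = 0 → ∀ e, b y (σ (flatten y) e) = a y e)
    (ha : Continuous fun p : TotalSpace M ((fun y : UpperHemisphere n => flatten y.1) *ᵖ E) =>
      (⟨p.1.1, a p.1.1 p.2⟩ : TotalSpace F' E'))
    (hb : Continuous fun p : TotalSpace N ((fun y : LowerHemisphere n => flatten y.1) *ᵖ F) =>
      (⟨p.1.1, b p.1.1 p.2⟩ : TotalSpace F' E'))
    (ha' : Continuous fun p : {p : TotalSpace F' E' // 0 ≤ lastCoord p.1} =>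
      (⟨flatten p.1.1, a' p.1.1 p.1.2⟩ : TotalSpace M E))
    (hb' : Continuous fun p : {p : TotalSpace F' E' // lastCoord p.1 ≤ 0} =>
      (⟨flatten p.1.1, b' p.1.1 p.1.2⟩ : TotalSpace N F)) :
    BundleIsomorphic (M × N) (Clutch σ) F' E' := by
  -- The clutched fibre is the quotient by `clutchRel`, so identifying this submodule with the
  -- kernel of a surjection onto `E' y` gives the fibrewise isomorphism.
  have hker : ∀ y, LinearMap.ker (joint a b y) = clutchRel σ y := by
    intro y
    ext ⟨e, f⟩
    change joint a b y (e, f) = 0 ↔ (0 < lastCoord y → e = 0) ∧ (lastCoord y < 0 → f = 0) ∧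
      (lastCoord y = 0 → f = -σ (flatten y) e)
    rcases lt_trichotomy (lastCoord y) 0 with h | h | h
    · simp only [joint, h.le, h.not_ge, h.not_gt, h, h.ne, LinearMap.coprod_apply, if_true, if_false,
        LinearMap.zero_apply, zero_add, false_imp_iff, true_imp_iff, true_and, and_true]
      refine ⟨fun hf => ?_, fun hf => by rw [hf, map_zero]⟩
      rw [← b'_b y h.le f, hf, ← map_zero (b y), b'_b y h.le]
    · simp only [joint, h, le_refl, lt_irrefl, LinearMap.coprod_apply, if_true,
        false_imp_iff, true_imp_iff, true_and]
      rw [← hab y h]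
      refine ⟨fun hf => ?_, fun hf => by rw [hf, map_neg, add_neg_cancel]⟩
      -- The hypothesis says `b f = b (-σ e)`; applying the left inverse `b'` gives `f = -σ e`.
      rw [← b'_b y h.le f, ← b'_b y h.le (-σ _ e), map_neg, ← eq_neg_of_add_eq_zero_right hf]
    · simp only [joint, h.le, h.not_ge, h.not_gt, h, h.ne', LinearMap.coprod_apply, if_true,
        if_false, LinearMap.zero_apply, add_zero, false_imp_iff, true_imp_iff, and_true]
      refine ⟨fun hf => ?_, fun hf => by rw [hf, map_zero]⟩
      rw [← a'_a y h.le e, hf, ← map_zero (a y), a'_a y h.le]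
  have hupper : ∀ y, 0 ≤ lastCoord y → ∀ e, joint a b y (e, 0) = a y e := by
    intro y h e
    simp [joint, h]
  have hlower : ∀ y, lastCoord y ≤ 0 → ∀ f, joint a b y (0, f) = b y f := by
    intro y h f
    simp [joint, h]
  have hsurj : ∀ y, Function.Surjective (joint a b y) := by
    intro y v
    rcases le_total 0 (lastCoord y) with h | h
    · exact ⟨(a' y v, 0), by rw [hupper y h, a_a' y h]⟩
    · exact ⟨(0, b' y v), by rw [hlower y h, b_b' y h]⟩
  let φ : ∀ y, Clutch σ y ≃ₗ[ℂ] E' y := fun y =>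
    (Submodule.quotEquivOfEq _ _ (hker y).symm).trans
      ((joint a b y).quotKerEquivOfSurjective (hsurj y))
  have hφ : ∀ y p, φ y ((clutchRel σ y).mkQ p) = joint a b y p := fun y p => rfl
  refine ⟨φ, continuous_coinduced_dom.2 (continuous_sum_dom.2 ⟨?_, ?_⟩), ?_⟩
  · refine ha.congr fun p => ?_
    change _ = (⟨p.1.1, φ p.1.1 ((clutchRel σ p.1.1).mkQ (p.2, 0))⟩ : TotalSpace F' E')
    exact congrArg (TotalSpace.mk p.1.1) ((hφ _ _).trans (hupper _ p.1.2 _)).symm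
  · refine hb.congr fun p => ?_
    change _ = (⟨p.1.1, φ p.1.1 ((clutchRel σ p.1.1).mkQ (0, p.2))⟩ : TotalSpace F' E')
    exact congrArg (TotalSpace.mk p.1.1) ((hφ _ _).trans (hlower _ p.1.2 _)).symm
  -- The inverse is glued from its restrictions to two closed sets covering the total space; over
  -- each hemisphere it is `a'` or `b'` followed by the continuous inclusion of that piece.
  have hquot : Continuous (Sum.elim (upper σ M N) (lower σ M N)) := continuous_coinduced_rng
  have hcl := continuous_lastCoord.comp hπ
  have hU : IsClosed {p : TotalSpace F' E' | 0 ≤ lastCoord p.1} :=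
    isClosed_le continuous_const hcl
  have hL : IsClosed {p : TotalSpace F' E' | lastCoord p.1 ≤ 0} :=
    isClosed_le hcl continuous_const
  rw [← continuousOn_univ, show (Set.univ : Set (TotalSpace F' E')) =
    {p | 0 ≤ lastCoord p.1} ∪ {p | lastCoord p.1 ≤ 0} from
      (Set.eq_univ_of_forall fun p : TotalSpace F' E' => (le_total 0 (lastCoord p.1) :)).symm]
  refine ContinuousOn.union_of_isClosed ?_ ?_ hU hL
  · rw [continuousOn_iff_continuous_domRestrict]
    have h1 : Continuous fun p : {p : TotalSpace F' E' // 0 ≤ lastCoord p.1} =>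
        (⟨⟨p.1.1, p.2⟩, a' p.1.1 p.1.2⟩ :
          TotalSpace M ((fun y : UpperHemisphere n => flatten y.1) *ᵖ E)) :=
      -- The pullback has the topology induced from base times total space, so the two components
      -- are checked separately.
      (inducing_pullbackTotalSpaceEmbedding _ _ _).continuous_iff.2
        (((hπ.comp continuous_subtype_val).subtype_mk _).prodMk ha')
    refine ((hquot.comp continuous_inl).comp h1).congr fun p => ?_
    change (⟨p.1.1, (clutchRel σ p.1.1).mkQ (a' p.1.1 p.1.2, 0)⟩ : TotalSpace (M × N) (Clutch σ)) =
      ⟨p.1.1, (φ p.1.1).symm p.1.2⟩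
    congr 1
    exact (φ p.1.1).eq_symm_apply.2
      ((hφ _ _).trans ((hupper _ p.2 _).trans (a_a' _ p.2 p.1.2)))
  · rw [continuousOn_iff_continuous_domRestrict]
    have h1 : Continuous fun p : {p : TotalSpace F' E' // lastCoord p.1 ≤ 0} =>
        (⟨⟨p.1.1, p.2⟩, b' p.1.1 p.1.2⟩ :
          TotalSpace N ((fun y : LowerHemisphere n => flatten y.1) *ᵖ F)) :=
      (inducing_pullbackTotalSpaceEmbedding _ _ _).continuous_iff.2
        (((hπ.comp continuous_subtype_val).subtype_mk _).prodMk hb')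
    refine ((hquot.comp continuous_inr).comp h1).congr fun p => ?_
    change (⟨p.1.1, (clutchRel σ p.1.1).mkQ (0, b' p.1.1 p.1.2)⟩ : TotalSpace (M × N) (Clutch σ)) =
      ⟨p.1.1, (φ p.1.1).symm p.1.2⟩
    congr 1
    exact (φ p.1.1).eq_symm_apply.2
      ((hφ _ _).trans ((hlower _ p.2 _).trans (b_b' _ p.2 p.1.2)))

end Criterion

end Clutch

/-! ### The two poles -/

theorem continuous_flatten {n : ℕ} : Continuous (flatten : Sph n → EuclideanSpace ℝ (Fin n)) := by
  unfold flatten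
  fun_prop

/-- The south pole `(0, …, 0, -1)` of `S^n`. -/
def southPole (n : ℕ) : Sph n := -northPole n

theorem inner_northPole {n : ℕ} (y : Sph n) : inner ℝ y.1 (northPole n).1 = lastCoord y := by
  simp [northPole, lastCoord, EuclideanSpace.inner_single_right]

theorem inner_southPole {n : ℕ} (y : Sph n) : inner ℝ y.1 (southPole n).1 = -lastCoord y := by
  rw [← inner_northPole, ← inner_neg_right]
  rfl

theorem equator_flatten {n : ℕ} {y : Sph n} (h : lastCoord y = 0) : equator (flatten y) = y.1 := by
  ext j
  refine Fin.lastCases ?_ (fun j => ?_) j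
  · simpa [equator, lastCoord] using h.symm
  · simp [equator, flatten]

theorem norm_flatten {n : ℕ} {y : Sph n} (h : lastCoord y = 0) : ‖flatten y‖ ^ 2 = 1 := by
  rw [← inner_equator_self, equator_flatten h, real_inner_self_eq_norm_sq, norm_eq_of_mem_sphere,
    one_pow]

theorem cliffordI_neg (r : ℕ) (x : EuclideanSpace ℝ (Fin (2 * r + 1))) :
    cliffordI r (-x) = -cliffordI r x := by
  simp [cliffordI]

theorem posSpinorSubspace_northPole (r : ℕ) :
    posSpinorSubspace r (northPole (2 * r)) = spinorPos r := by
  rw [posSpinorSubspace, spinorPos, grading_eq]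

/-- Clifford multiplication is odd, so its operator at the south pole is minus the grading. -/
theorem posSpinorSubspace_southPole (r : ℕ) :
    posSpinorSubspace r (southPole (2 * r)) = spinorNeg r := by
  ext v
  rw [PosSpinorBundle.mem_posSpinorSubspace, mem_spinorNeg, grading_eq]
  change cliffordI r (-(northPole (2 * r)).1) v = v ↔ _
  rw [cliffordI_neg, neg_apply, neg_eq_iff_eq_neg]

/-! ### Trivializing `S⁺` by projection from a polar fibre -/

namespace PosSpinorBundle

variable {r : ℕ}

theorem proj_incl (x : Sph (2 * r)) (v : PosSpinorBundle r x) : proj x (incl x v) = v := by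
  apply incl_injective
  rw [incl_proj, cliffordI_incl]
  module

/-- The map to the fibre at `y` from a subspace identified with the fibre at `u`. -/
def fromFibre {u : Sph (2 * r)} {V : Submodule ℂ (Spinor r)} (_ : posSpinorSubspace r u = V)
    (y : Sph (2 * r)) : V →L[ℂ] PosSpinorBundle r y :=
  (proj y).comp V.subtypeL

theorem fromFibre_apply {u : Sph (2 * r)} {V : Submodule ℂ (Spinor r)}
    (h : posSpinorSubspace r u = V) (y : Sph (2 * r)) (v : V) :
    fromFibre h y v = proj y v := rfl

/-- The inverse of `fromFibre`, as long as `y` is not antipodal to `u`. -/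
def toFibre {u : Sph (2 * r)} {V : Submodule ℂ (Spinor r)} (h : posSpinorSubspace r u = V)
    (y : Sph (2 * r)) (w : PosSpinorBundle r y) : V :=
  (((1 + inner ℝ y.1 u.1) / 2 : ℝ) : ℂ)⁻¹ • ⟨incl u (proj u (incl y w)), h ▸ (proj u (incl y w)).2⟩

theorem toFibre_fromFibre {u : Sph (2 * r)} {V : Submodule ℂ (Spinor r)}
    (h : posSpinorSubspace r u = V) {y : Sph (2 * r)} (hy : 1 + inner ℝ y.1 u.1 ≠ 0) (v : V) :
    toFibre h y (fromFibre h y v) = v := by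
  -- `V` equals the fibre at `u` only propositionally; after the substitution its elements can be
  -- fed to `proj` and `incl`.
  subst h
  have hc : (((1 + inner ℝ y.1 u.1) / 2 : ℝ) : ℂ) ≠ 0 := by
    exact_mod_cast div_ne_zero hy two_ne_zero
  apply Subtype.ext
  suffices h : ∀ w : PosSpinorBundle r u, (((1 + inner ℝ y.1 u.1) / 2 : ℝ) : ℂ)⁻¹ •
      incl u (proj u (incl y (proj y (incl u w)))) = incl u w from h v
  intro w
  -- The compression of `P_y` to the fibre at `u` is the scalar `(1 + ⟨u, y⟩) / 2`, which the factor
  -- in `toFibre` cancels by symmetry of the inner product.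
  rw [proj_incl_proj, map_smul, real_inner_comm y.1, inv_smul_smul₀ hc]

theorem fromFibre_toFibre {u : Sph (2 * r)} {V : Submodule ℂ (Spinor r)}
    (h : posSpinorSubspace r u = V) {y : Sph (2 * r)} (hy : 1 + inner ℝ y.1 u.1 ≠ 0)
    (w : PosSpinorBundle r y) : fromFibre h y (toFibre h y w) = w := by
  have hc : (((1 + inner ℝ y.1 u.1) / 2 : ℝ) : ℂ) ≠ 0 := by
    exact_mod_cast div_ne_zero hy two_ne_zero
  rw [toFibre, map_smul, fromFibre_apply, proj_incl_proj, inv_smul_smul₀ hc]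

/-- The topology of `S⁺` is induced from the sphere times `Δ`, so this reduces to norm continuity of
`y ↦ P_y`. -/
theorem continuous_fromFibre {u : Sph (2 * r)} {V : Submodule ℂ (Spinor r)}
    (h : posSpinorSubspace r u = V) : Continuous fun q : Sph (2 * r) × V =>
      (⟨q.1, fromFibre h q.1 q.2⟩ : TotalSpace (spinorPos r) (PosSpinorBundle r)) :=
  isInducing_total.continuous_iff.2 (continuous_fst.prodMk
    ((continuous_incl_proj.comp continuous_fst).clm_apply
      (continuous_subtype_val.comp continuous_snd)))

theorem continuousOn_toFibre {u : Sph (2 * r)} {V : Submodule ℂ (Spinor r)}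
    (h : posSpinorSubspace r u = V) :
    ContinuousOn (fun p : TotalSpace (spinorPos r) (PosSpinorBundle r) => toFibre h p.1 p.2)
      {p | 1 + inner ℝ p.1.1 u.1 ≠ 0} := by
  have hπ : Continuous (fun p : TotalSpace (spinorPos r) (PosSpinorBundle r) => p.1) :=
    continuous_fst.comp isInducing_total.continuous
  have hc : Continuous fun p : TotalSpace (spinorPos r) (PosSpinorBundle r) =>
      (((1 + inner ℝ p.1.1 u.1) / 2 : ℝ) : ℂ) := by fun_prop
  refine ContinuousOn.smul (hc.continuousOn.inv₀ fun q hq => ?_) (Continuous.continuousOn ?_)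
  · exact_mod_cast div_ne_zero hq two_ne_zero
  · exact (((incl u).comp (proj u)).continuous.comp
      (continuous_snd.comp isInducing_total.continuous)).subtype_mk _

/-- This is where the clutching map enters. On the equator `i c(y)` is `σ` with `σ² = 1`, so `1 + i
c(y)` takes the same value on `e` and on `σ e`. -/
theorem fromFibre_diracSymbolPos {y : Sph (2 * r)} (h : lastCoord y = 0) (e : spinorPos r) :
    fromFibre (posSpinorSubspace_southPole r) y (diracSymbolPos r (flatten y) e) =
      fromFibre (posSpinorSubspace_northPole r) y e := by
  apply incl_injective
  rw [fromFibre_apply, fromFibre_apply, incl_proj, incl_proj, coe_diracSymbolPos,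
    ← equator_flatten h, cliffordI_equator, diracSymbol_sq, norm_flatten h, add_comm]
  simp

end PosSpinorBundle

/-! ### Self-adjointness of Clifford multiplication and duality -/

theorem blockMatrix_conjTranspose {r : ℕ} (A B C D : Matrix (Fin (2 ^ r)) (Fin (2 ^ r)) ℂ) :
    (blockMatrix A B C D).conjTranspose =
      blockMatrix A.conjTranspose C.conjTranspose B.conjTranspose D.conjTranspose := by
  simp only [blockMatrix, Matrix.conjTranspose_reindex, Matrix.fromBlocks_conjTranspose]

theorem neg_blockMatrix {r : ℕ} (A B C D : Matrix (Fin (2 ^ r)) (Fin (2 ^ r)) ℂ) :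
    -blockMatrix A B C D = blockMatrix (-A) (-B) (-C) (-D) := by
  simpa using blockMatrix_smul (-1) A B C D

/-- Induction on the recursion: `-i` is imaginary, the symmetric block pattern inherits skewness
from its entry, and the two new matrices are visibly skew-Hermitian. This makes each `i x_j E_j`
self-adjoint. -/
theorem diracE_conjTranspose : ∀ (r : ℕ) (j : Fin (2 * r + 1)),
    (diracE r j).conjTranspose = -diracE r j
  | 0, j => by simp [diracE]
  | r + 1, j => by
    by_cases h : (j : ℕ) < 2 * r + 1
    · simp [diracE, h, blockMatrix_conjTranspose, neg_blockMatrix, diracE_conjTranspose r]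
    · by_cases h' : (j : ℕ) = 2 * r + 1
      · simp [diracE, h', blockMatrix_conjTranspose, neg_blockMatrix]
      · simp [diracE, h, h', blockMatrix_conjTranspose, neg_blockMatrix]

theorem isSelfAdjoint_cliffordI (r : ℕ) (x : EuclideanSpace ℝ (Fin (2 * r + 1))) :
    IsSelfAdjoint (cliffordI r x) := by
  refine IsSelfAdjoint.map ?_ (Matrix.toEuclideanCLM (𝕜 := ℂ) (n := Fin (2 ^ r)))
  simp [IsSelfAdjoint, Matrix.star_eq_conjTranspose, diracE_conjTranspose]

/-! ### The Hermitian duality between `S⁺` and its dual -/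

namespace PosSpinorBundle

variable {r : ℕ}

theorem continuous_totalSpace_proj :
    Continuous (π (spinorPos r) (PosSpinorBundle r)) :=
  continuous_fst.comp isInducing_total.continuous

/-- The projection is half of `1` plus a self-adjoint operator, hence orthogonal. -/
theorem inner_incl_proj (x : Sph (2 * r)) (v w : Spinor r) :
    inner ℂ (incl x (proj x v)) w = inner ℂ v (incl x (proj x w)) := by
  have h : inner ℂ (cliffordI r x.1 v) w = inner ℂ v (cliffordI r x.1 w) :=
    (isSelfAdjoint_cliffordI r x.1).isSymmetric v w
  rw [incl_proj, incl_proj, inner_smul_left, inner_smul_right, inner_add_left, inner_add_right, h]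
  simp [Complex.conj_ofNat]

/-- The conjugate-linear map `v ↦ ⟨v, ·⟩` from a fibre of `S⁺` to its dual. -/
def toBott (x : Sph (2 * r)) : PosSpinorBundle r x →ₛₗ[starRingEnd ℂ] BottBundle r x where
  toFun v := (innerSL ℂ (incl x v)).comp (incl x)
  map_add' v w := by
    ext u
    exact (congrArg (inner ℂ · (incl x u)) (map_add (incl x) v w)).trans (inner_add_left _ _ _)
  map_smul' c v := by
    ext u
    exact (congrArg (inner ℂ · (incl x u)) (map_smul (incl x) c v)).trans (inner_smul_left _ _ _)

theorem toBott_apply (x : Sph (2 * r)) (v w : PosSpinorBundle r x) :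
    toBott x v w = inner ℂ (incl x v) (incl x w) := rfl

/-- The spinor that represents the functional `ξ ∘ proj x` on `Δ`. -/
def representative (x : Sph (2 * r)) (ξ : BottBundle r x) : Spinor r :=
  WithLp.toLp 2 fun i => starRingEnd ℂ (ξ (proj x (EuclideanSpace.single i 1)))

/-- Expand `w` in the standard basis; `inner ℂ` is conjugate-linear in its first slot, which undoes
the conjugation in `representative`. The explicit coordinates, in place of an abstract Riesz vector,
are what make continuity in `x` and `ξ` accessible. -/
theorem inner_representative (x : Sph (2 * r)) (ξ : BottBundle r x) (w : Spinor r) :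
    inner ℂ (representative x ξ) w = ξ (proj x w) := by
  have hw : w = ∑ i, w i • EuclideanSpace.single i (1 : ℂ) := by
    ext j
    simp [Pi.single_apply]
  have h : ξ (proj x w) = ∑ i, w i • ξ (proj x (EuclideanSpace.single i 1)) := by
    conv_lhs => rw [hw]
    simp only [map_sum, map_smul]
  rw [h, PiLp.inner_apply]
  simp [representative]

/-- The inverse of `toBott`. -/
def ofBott (x : Sph (2 * r)) (ξ : BottBundle r x) : PosSpinorBundle r x :=
  proj x (representative x ξ)

/-- Projecting the representative is harmless: self-adjointness moves the projection onto `w`, which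
it fixes. -/
theorem toBott_ofBott (x : Sph (2 * r)) (ξ : BottBundle r x) : toBott x (ofBott x ξ) = ξ := by
  ext w
  rw [toBott_apply, ofBott, inner_incl_proj, proj_incl, inner_representative, proj_incl]

/-- Positive definiteness: evaluate the difference of the functionals at `v - w`. -/
theorem toBott_injective (x : Sph (2 * r)) : Function.Injective (toBott x) := by
  intro v w h
  apply incl_injective
  rw [← sub_eq_zero, ← map_sub, ← inner_self_eq_zero (𝕜 := ℂ), ← toBott_apply,
    map_sub (toBott x), h, sub_self]
  rfl

theorem ofBott_toBott (x : Sph (2 * r)) (v : PosSpinorBundle r x) : ofBott x (toBott x v) = v :=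
  toBott_injective x (toBott_ofBott x _)

/-! ### Continuity of the duality maps -/

variable [NeZero r]

/-- In the trivialization centred at `u`, the functional `⟨v, ·⟩` at `p` reads `w ↦ c⁻¹ ⟨v, P_p (τ⁻¹
w)⟩` with `c = (1 + ⟨p, u⟩) / 2`, visibly continuous while `c ≠ 0`. -/
theorem continuous_toBott : Continuous fun p : TotalSpace (spinorPos r) (PosSpinorBundle r) =>
    (⟨p.1, toBott p.1 p.2⟩ : TotalSpace (spinorPos r →L[ℂ] ℂ) (BottBundle r)) := by
  rw [continuous_iff_continuousAt]
  intro p₀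
  refine (continuousAt_hom_bundle _ _).2 ⟨continuous_totalSpace_proj.continuousAt, ?_⟩
  let u := p₀.1
  -- This choice makes `triv u τ` the preferred trivialization at `u` by definition.
  let τ : PosSpinorBundle r u ≃L[ℂ] spinorPos r := (nonempty_equiv u).some
  have hb : u ∈ (triv u τ).baseSet := mem_baseSet_trivializationAt (spinorPos r) (PosSpinorBundle r) u
  have hc : Continuous fun p : TotalSpace (spinorPos r) (PosSpinorBundle r) =>
      (((1 + inner ℝ p.1.1 u.1) / 2 : ℝ) : ℂ) := by
    have := continuous_totalSpace_proj (r := r)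
    fun_prop
  have h1 : ContinuousAt (fun p : TotalSpace (spinorPos r) (PosSpinorBundle r) =>
      (((1 + inner ℝ p.1.1 u.1) / 2 : ℝ) : ℂ)⁻¹) p₀ :=
    hc.continuousAt.inv₀ (by exact_mod_cast div_ne_zero hb two_ne_zero)
  have h2 : Continuous fun p : TotalSpace (spinorPos r) (PosSpinorBundle r) =>
      (innerSL ℂ (incl p.1 p.2)).comp (((incl p.1).comp (proj p.1)).comp
        ((incl u).comp (τ.symm : spinorPos r →L[ℂ] PosSpinorBundle r u))) :=
    ((innerSL ℂ).continuous.comp (continuous_snd.comp isInducing_total.continuous)).clm_comp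
      ((continuous_incl_proj.comp continuous_totalSpace_proj).clm_comp continuous_const)
  refine (h1.smul h2.continuousAt).congr_of_eventuallyEq ?_
  filter_upwards [continuous_totalSpace_proj.continuousAt.preimage_mem_nhds
    ((triv u τ).open_baseSet.mem_nhds hb)] with p hp
  ext w
  have hs : (triv u τ).symmL ℂ p.1 w =
      (((1 + inner ℝ p.1.1 u.1) / 2 : ℝ) : ℂ)⁻¹ • proj p.1 (incl u (τ.symm w)) := by
    rw [Trivialization.symmL_apply _ hp]
    exact TotalSpace.mk_inj.1 ((triv u τ).mk_symm hp w)
  have hin : ContinuousLinearMap.inCoordinates (spinorPos r) (PosSpinorBundle r) ℂ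
      (Trivial (Sph (2 * r)) ℂ) p₀.1 p.1 p₀.1 p.1 (toBott p.1 p.2) w =
        toBott p.1 p.2 ((triv u τ).symmL ℂ p.1 w) := by
    -- On the target, a trivial line bundle, the coordinate map is the identity.
    exact congrArg (fun T : ℂ →L[ℂ] ℂ => T (toBott p.1 p.2 ((triv u τ).symmL ℂ p.1 w)))
      (Trivial.continuousLinearMapAt_trivialization ℂ (Sph (2 * r)) ℂ p.1)
  rw [hin, hs, toBott_apply, map_smul, inner_smul_right]
  rfl

theorem continuous_bott_proj : Continuous (π (spinorPos r →L[ℂ] ℂ) (BottBundle r)) :=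
  FiberBundle.continuous_proj _ _

/-- It suffices that `representative` is continuous. Its coordinates are conjugates of `ξ` paired
with the continuous sections `x ↦ P_x e_i`, and pairing is continuous in a Hom bundle. -/
theorem continuous_ofBott : Continuous fun p : TotalSpace (spinorPos r →L[ℂ] ℂ) (BottBundle r) =>
    (⟨p.1, ofBott p.1 p.2⟩ : TotalSpace (spinorPos r) (PosSpinorBundle r)) := by
  have hsec : ∀ w : Spinor r, Continuous fun p : TotalSpace (spinorPos r →L[ℂ] ℂ) (BottBundle r) =>
      (⟨p.1, proj p.1 w⟩ : TotalSpace (spinorPos r) (PosSpinorBundle r)) := fun w =>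
    isInducing_total.continuous_iff.2 (continuous_bott_proj.prodMk
      ((continuous_incl_proj.comp continuous_bott_proj).clm_apply continuous_const))
  have happ : ∀ w : Spinor r, Continuous fun p : TotalSpace (spinorPos r →L[ℂ] ℂ) (BottBundle r) =>
      (p.2 (proj p.1 w) : ℂ) := fun w =>
    continuous_snd.comp ((Trivial.isInducing_toProd (Sph (2 * r)) ℂ).continuous.comp
      (Continuous.clm_bundle_apply (E₁ := PosSpinorBundle r) (E₂ := Trivial (Sph (2 * r)) ℂ)
        (F₁ := spinorPos r) (F₂ := ℂ)
        (b := fun p : TotalSpace (spinorPos r →L[ℂ] ℂ) (BottBundle r) => p.1) (ϕ := fun p => p.2)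
        continuous_id (hsec w)))
  have hrep : Continuous fun p : TotalSpace (spinorPos r →L[ℂ] ℂ) (BottBundle r) =>
      representative p.1 p.2 :=
    (PiLp.continuous_toLp 2 _).comp (continuous_pi fun i => Complex.continuous_conj.comp (happ _))
  exact isInducing_total.continuous_iff.2 (continuous_bott_proj.prodMk
    ((continuous_incl_proj.comp continuous_bott_proj).clm_apply hrep))

end PosSpinorBundle

/-! ### The clutched bundles -/

namespace ConjSpace

/-- A conjugate-linear map is a linear map on the conjugate space. -/
def lift {V W : Type*} [AddCommGroup V] [Module ℂ V] [AddCommGroup W] [Module ℂ W]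
    (f : V →ₛₗ[starRingEnd ℂ] W) : ConjSpace V →ₗ[ℂ] W where
  toFun := f
  map_add' := f.map_add
  -- The scalar acts on `ConjSpace V` through its conjugate, and `f` conjugates it back.
  map_smul' c v := (f.map_smulₛₗ (starRingEnd ℂ c) v).trans (by rw [Complex.conj_conj]; rfl)

end ConjSpace

namespace PosSpinorBundle

variable {r : ℕ}

/-- The value is one plus the last coordinate, so a closed hemisphere avoids the antipode of its own
pole. -/
theorem one_add_inner_northPole_ne_zero {n : ℕ} {y : Sph n} (h : 0 ≤ lastCoord y) :
    1 + inner ℝ y.1 (northPole n).1 ≠ 0 := by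
  rw [inner_northPole]
  positivity

theorem one_add_inner_southPole_ne_zero {n : ℕ} {y : Sph n} (h : lastCoord y ≤ 0) :
    1 + inner ℝ y.1 (southPole n).1 ≠ 0 := by
  rw [inner_southPole]
  linarith

/-- `fromFibre` is continuous on the pullback of a trivial bundle to a space over the sphere. -/
theorem continuous_fromFibre_pullback {u : Sph (2 * r)} {V : Submodule ℂ (Spinor r)}
    (h : posSpinorSubspace r u = V) {H : Type*} [TopologicalSpace H] {ι : H → Sph (2 * r)}
    (hι : Continuous ι) :
    Continuous fun p : TotalSpace V ((fun y => flatten (ι y)) *ᵖ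
        (Trivial (EuclideanSpace ℝ (Fin (2 * r))) V)) =>
      (⟨ι p.1, fromFibre h (ι p.1) p.2⟩ : TotalSpace (spinorPos r) (PosSpinorBundle r)) :=
  (continuous_fromFibre h).comp ((hι.comp (Pullback.continuous_proj _ _ _)).prodMk
    (continuous_snd.comp ((Trivial.isInducing_toProd _ V).continuous.comp
      (Pullback.continuous_lift _ _ _))))

theorem continuous_toFibre_subtype {u : Sph (2 * r)} {V : Submodule ℂ (Spinor r)}
    (h : posSpinorSubspace r u = V) {P : Sph (2 * r) → Prop}
    (hP : ∀ y, P y → 1 + inner ℝ y.1 u.1 ≠ 0) :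
    Continuous fun p : {p : TotalSpace (spinorPos r) (PosSpinorBundle r) // P p.1} =>
      (⟨flatten p.1.1, toFibre h p.1.1 p.1.2⟩ :
        TotalSpace V (Trivial (EuclideanSpace ℝ (Fin (2 * r))) V)) :=
  (Trivial.isInducing_toProd _ V).continuous_iff.2
    ((continuous_flatten.comp (continuous_totalSpace_proj.comp continuous_subtype_val)).prodMk
      ((continuousOn_toFibre h).comp_continuous continuous_subtype_val fun p => hP _ p.2))

theorem clutch_isomorphic :
    BundleIsomorphic
      (spinorPos r × spinorNeg r)
      (Clutch (E := Bundle.Trivial (EuclideanSpace ℝ (Fin (2 * r))) (spinorPos r))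
        (F := Bundle.Trivial (EuclideanSpace ℝ (Fin (2 * r))) (spinorNeg r))
        (diracSymbolPos r))
      (spinorPos r) (PosSpinorBundle r) :=
  Clutch.bundleIsomorphic (E := Bundle.Trivial (EuclideanSpace ℝ (Fin (2 * r))) (spinorPos r))
    (F := Bundle.Trivial (EuclideanSpace ℝ (Fin (2 * r))) (spinorNeg r)) _ _ _ _
    continuous_totalSpace_proj
    (fun y => (fromFibre (posSpinorSubspace_northPole r) y).toLinearMap)
    (fun y => (fromFibre (posSpinorSubspace_southPole r) y).toLinearMap)
    (toFibre (posSpinorSubspace_northPole r))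
    (toFibre (posSpinorSubspace_southPole r))
    (fun _ h => toFibre_fromFibre _ (one_add_inner_northPole_ne_zero h))
    (fun _ h => fromFibre_toFibre _ (one_add_inner_northPole_ne_zero h))
    (fun _ h => toFibre_fromFibre _ (one_add_inner_southPole_ne_zero h))
    (fun _ h => fromFibre_toFibre _ (one_add_inner_southPole_ne_zero h))
    (fun _ h => fromFibre_diracSymbolPos h)
    (continuous_fromFibre_pullback _ continuous_subtype_val)
    (continuous_fromFibre_pullback _ continuous_subtype_val)
    (continuous_toFibre_subtype _ fun _ => one_add_inner_northPole_ne_zero)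
    (continuous_toFibre_subtype _ fun _ => one_add_inner_southPole_ne_zero)

variable [NeZero r]

theorem continuous_toBott_fromFibre_pullback {u : Sph (2 * r)} {V : Submodule ℂ (Spinor r)}
    (h : posSpinorSubspace r u = V) {H : Type*} [TopologicalSpace H] {ι : H → Sph (2 * r)}
    (hι : Continuous ι) :
    Continuous fun p : TotalSpace (ConjSpace V) ((fun y => flatten (ι y)) *ᵖ
        (fun x => ConjSpace (Trivial (EuclideanSpace ℝ (Fin (2 * r))) V x))) =>
      (⟨ι p.1, toBott (ι p.1) (fromFibre h (ι p.1) p.2)⟩ :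
        TotalSpace (spinorPos r →L[ℂ] ℂ) (BottBundle r)) := by
  -- Conjugation leaves the total space and its topology unchanged, so the argument passes to the
  -- original trivial bundle.
  have hc : Continuous fun p : TotalSpace (ConjSpace V)
      (fun x => ConjSpace (Trivial (EuclideanSpace ℝ (Fin (2 * r))) V x)) =>
      (⟨p.1, p.2⟩ : TotalSpace V (Trivial (EuclideanSpace ℝ (Fin (2 * r))) V)) :=
    continuous_induced_dom
  exact continuous_toBott.comp ((continuous_fromFibre h).comp
    ((hι.comp (Pullback.continuous_proj _ _ _)).prodMk
      (continuous_snd.comp ((Trivial.isInducing_toProd _ V).continuous.comp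
        (hc.comp (Pullback.continuous_lift _ _ _))))))

theorem continuous_toFibre_ofBott_subtype {u : Sph (2 * r)} {V : Submodule ℂ (Spinor r)}
    (h : posSpinorSubspace r u = V) {P : Sph (2 * r) → Prop}
    (hP : ∀ y, P y → 1 + inner ℝ y.1 u.1 ≠ 0) :
    Continuous fun p : {p : TotalSpace (spinorPos r →L[ℂ] ℂ) (BottBundle r) // P p.1} =>
      (⟨flatten p.1.1, toFibre h p.1.1 (ofBott p.1.1 p.1.2)⟩ : TotalSpace (ConjSpace V)
        (fun x => ConjSpace (Trivial (EuclideanSpace ℝ (Fin (2 * r))) V x))) :=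
  continuous_induced_rng.2 ((continuous_toFibre_subtype h hP).comp
    ((continuous_ofBott.comp continuous_subtype_val).subtype_mk fun p => p.2))

/-- Every ingredient is the one for `S⁺` followed by `toBott`, or preceded by `ofBott` for the
inverses; the equatorial condition is the earlier one with `toBott` applied. -/
theorem conj_clutch_isomorphic :
    BundleIsomorphic
      (ConjSpace (spinorPos r) × ConjSpace (spinorNeg r))
      (Clutch
        (E := fun x => ConjSpace (Bundle.Trivial (EuclideanSpace ℝ (Fin (2 * r))) (spinorPos r) x))
        (F := fun x => ConjSpace (Bundle.Trivial (EuclideanSpace ℝ (Fin (2 * r))) (spinorNeg r) x))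
        (fun x => ConjSpace.map (diracSymbolPos r x)))
      (spinorPos r →L[ℂ] ℂ) (BottBundle r) :=
  Clutch.bundleIsomorphic
    (E := fun x => ConjSpace (Bundle.Trivial (EuclideanSpace ℝ (Fin (2 * r))) (spinorPos r) x))
    (F := fun x => ConjSpace (Bundle.Trivial (EuclideanSpace ℝ (Fin (2 * r))) (spinorNeg r) x))
    _ _ _ _ continuous_bott_proj
    (fun y => ConjSpace.lift ((toBott y).comp
      (fromFibre (posSpinorSubspace_northPole r) y).toLinearMap))
    (fun y => ConjSpace.lift ((toBott y).comp
      (fromFibre (posSpinorSubspace_southPole r) y).toLinearMap))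
    (fun y ξ => toFibre (posSpinorSubspace_northPole r) y (ofBott y ξ))
    (fun y ξ => toFibre (posSpinorSubspace_southPole r) y (ofBott y ξ))
    (fun y h e => (congrArg (toFibre _ y) (ofBott_toBott y _)).trans
      (toFibre_fromFibre _ (one_add_inner_northPole_ne_zero h) e))
    (fun y h ξ => (congrArg (toBott y) (fromFibre_toFibre _
      (one_add_inner_northPole_ne_zero h) _)).trans (toBott_ofBott y ξ))
    (fun y h e => (congrArg (toFibre _ y) (ofBott_toBott y _)).trans
      (toFibre_fromFibre _ (one_add_inner_southPole_ne_zero h) e))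
    (fun y h ξ => (congrArg (toBott y) (fromFibre_toFibre _
      (one_add_inner_southPole_ne_zero h) _)).trans (toBott_ofBott y ξ))
    (fun y h e => congrArg (toBott y) (fromFibre_diracSymbolPos h e))
    (continuous_toBott_fromFibre_pullback _ continuous_subtype_val)
    (continuous_toBott_fromFibre_pullback _ continuous_subtype_val)
    (continuous_toFibre_ofBott_subtype _ fun _ => one_add_inner_northPole_ne_zero)
    (continuous_toFibre_ofBott_subtype _ fun _ => one_add_inner_southPole_ne_zero)

end PosSpinorBundle

end

theorem mainTheorem10 (r : ℕ) [NeZero r] :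
    BundleIsomorphic
      (spinorPos r × spinorNeg r)
      (Clutch (E := Bundle.Trivial (EuclideanSpace ℝ (Fin (2 * r))) (spinorPos r))
        (F := Bundle.Trivial (EuclideanSpace ℝ (Fin (2 * r))) (spinorNeg r))
        (diracSymbolPos r))
      (spinorPos r) (PosSpinorBundle r) ∧
    BundleIsomorphic
      (ConjSpace (spinorPos r) × ConjSpace (spinorNeg r))
      (Clutch
        (E := fun x => ConjSpace (Bundle.Trivial (EuclideanSpace ℝ (Fin (2 * r))) (spinorPos r) x))
        (F := fun x => ConjSpace (Bundle.Trivial (EuclideanSpace ℝ (Fin (2 * r))) (spinorNeg r) x))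
        (fun x => ConjSpace.map (diracSymbolPos r x)))
      (spinorPos r →L[ℂ] ℂ) (BottBundle r) :=
  ⟨PosSpinorBundle.clutch_isomorphic, PosSpinorBundle.conj_clutch_isomorphic⟩
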